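/- Let $d\in\mathbb N$, $\mu\in\mathbb R^d$, and let $K\in\mathbb R^{d\times d}$ be symmetric positive definite. A random vector $X$ in $\mathbb R^d$ is elliptical, $X\sim E(\mu,\Sigma)$ with $\Sigma$ positive semi-definite, if its characteristic function is $t\mapsto\phi(t^T\Sigma t)\,e^{i\mu^Tt}$ for some $\phi:[0,\infty)\to\mathbb R$. A random vector $Y=(Y_1,\dots,Y_d)$ is transelliptical, $Y\sim\mathrm{TE}(\mu,\Sigma)$ with marginal transforms $f_1,\dots,f_d$, if $f_1,\dots,f_d$ are fixed real functions, each $f_k$ strictly increasing (at least on a set in which $Y_k$ lies almost surely), and $f(Y):=(f_1(Y_1),\dots,f_d(Y_d))\sim E(\mu,\Sigma)$. **Theorem.** Suppose that $Y\sim\mathrm{TE}(\mu,K^{-1})$ with marginal transforms $f_1,\dots,f_d$, and that $X=f(Y)$ satisfies $0<\mathbb E\big[(X-\mu)^TK(X-\mu)\big]<\infty$. Let $i\ne j$ be two indices in $\{1,\dots,d\}$ and let $Y_{(ij)}$ denote $Y$ with the coordinates $Y_i$ and $Y_j$ removed (so for $d=2$ conditioning on $Y_{(ij)}$ is no conditioning).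 Then $K_{ij}=0$ if and only if $$\mathrm{cov}\big(f_i(Y_i),\,g(Y_j)\,\big|\,Y_{(ij)}\big)=0\quad\text{almost surely}$$ for every Borel function $g:\mathbb R\to\mathbb R$ for which this conditional covariance exists. Here $\mathrm{cov}(U,V\mid Z)$ is the covariance of $U$ and $V$ under the regular conditional distribution of $(U,V)$ given $Z$, and it exists if, almost surely, $U$, $V$ and $UV$ are integrable under that conditional distribution. -/

import Mathlib

open MeasureTheory ProbabilityTheory
open scoped Matrix

noncomputable section

/-- The random vector `X` has the elliptical distribution `E(m, S)`: its characteristic function is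
`t ↦ φ(tᵀ S t) exp(i mᵀ t)` for some real function `φ`. As `S` is positive semi-definite, only the
values of `φ` on `[0, ∞)` matter. -/
structure IsElliptical {Ω : Type*} [MeasurableSpace Ω] {d : ℕ}
    (X : Ω → EuclideanSpace ℝ (Fin d)) (P : Measure Ω)
    (m : EuclideanSpace ℝ (Fin d)) (S : Matrix (Fin d) (Fin d) ℝ) : Prop where
  aemeasurable : AEMeasurable X P
  posSemidef : S.PosSemidef
  exists_charFun : ∃ φ : ℝ → ℝ, ∀ t : EuclideanSpace ℝ (Fin d),
    charFun (P.map X) t =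
      (φ (t.ofLp ⬝ᵥ (S *ᵥ t.ofLp)) : ℂ) * Complex.exp (Complex.I * (inner ℝ m t : ℝ))

/-- The vector `f(Y) = (f₁(Y₁), …, f_d(Y_d))`. -/
def latent {Ω : Type*} {d : ℕ} (f : Fin d → ℝ → ℝ) (Y : Ω → EuclideanSpace ℝ (Fin d)) :
    Ω → EuclideanSpace ℝ (Fin d) :=
  fun ω => WithLp.toLp 2 (fun k => f k (Y ω k))

/-- `Y ∼ TE(m, S)` with marginal transforms `f₁, …, f_d`: each `f_k` is strictly increasing and
`f(Y) ∼ E(m, S)`. It suffices that `f_k` is strictly increasing on a set in which `Y_k` lies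
almost surely (the whole line, or for instance `(0, ∞)` when `f_k = log` and `Y_k > 0`). -/
structure IsTranselliptical {Ω : Type*} [MeasurableSpace Ω] {d : ℕ}
    (f : Fin d → ℝ → ℝ) (Y : Ω → EuclideanSpace ℝ (Fin d)) (P : Measure Ω)
    (m : EuclideanSpace ℝ (Fin d)) (S : Matrix (Fin d) (Fin d) ℝ) : Prop where
  aemeasurable : AEMeasurable Y P
  strictMono : ∀ k, ∃ D : Set ℝ, (∀ᵐ ω ∂P, Y ω k ∈ D) ∧ StrictMonoOn (f k) D
  elliptical : IsElliptical (latent f Y) P m S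

/-- `(x - m)ᵀ K (x - m)`. If `K = Σ⁻¹` and `X = m + ξ Σ^{1/2} U` with `U` on the unit sphere and
`ξ ≥ 0`, then the value at `X` is `ξ²`. -/
def radiusSq {d : ℕ} (m : EuclideanSpace ℝ (Fin d)) (K : Matrix (Fin d) (Fin d) ℝ)
    (x : EuclideanSpace ℝ (Fin d)) : ℝ :=
  (x - m).ofLp ⬝ᵥ (K *ᵥ (x - m).ofLp)

/-- The subvector `y_{(ij)}` obtained from `y` by removing the coordinates `i` and `j`. -/
def removeTwo {d : ℕ} (i j : Fin d) (y : EuclideanSpace ℝ (Fin d)) :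
    {k : Fin d // k ≠ i ∧ k ≠ j} → ℝ :=
  fun k => y k.1

/-- The conditional covariance of `U` and `V` given `Z = z` exists: `U`, `V` and `U V` are
integrable under the (regular) conditional distribution of `(U, V)` given `Z = z`. -/
def CondCovExists {Ω β : Type*} [MeasurableSpace Ω] [MeasurableSpace β]
    (U V : Ω → ℝ) (Z : Ω → β) (P : Measure Ω) [IsFiniteMeasure P] (z : β) : Prop :=
  Integrable (fun p : ℝ × ℝ => p.1) (condDistrib (fun ω => (U ω, V ω)) Z P z) ∧
  Integrable (fun p : ℝ × ℝ => p.2) (condDistrib (fun ω => (U ω, V ω)) Z P z) ∧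
  Integrable (fun p : ℝ × ℝ => p.1 * p.2) (condDistrib (fun ω => (U ω, V ω)) Z P z)

/-- The conditional covariance `cov(U, V | Z = z)`: the covariance of the two coordinates under
the (regular) conditional distribution of `(U, V)` given `Z = z`. -/
def condCov {Ω β : Type*} [MeasurableSpace Ω] [MeasurableSpace β]
    (U V : Ω → ℝ) (Z : Ω → β) (P : Measure Ω) [IsFiniteMeasure P] (z : β) : ℝ :=
  covariance (fun p : ℝ × ℝ => p.1) (fun p : ℝ × ℝ => p.2)
    (condDistrib (fun ω => (U ω, V ω)) Z P z)

end

/-!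
The latent vector `X = f(Y)` has an elliptical law, whose characteristic function depends on `t`
only through `tᵀ K⁻¹ t` and the phase `mᵀ t`. The reflection `x ↦ x - (2 / Kᵢᵢ) (K (x - m))ᵢ eᵢ` is
orthogonal for the inner product with matrix `K`, so it preserves the law of `X`
(`IsElliptical.map_axisReflection`). It fixes all coordinates but the `i`-th, and it changes the
sign of the residual `(K (X - m))ᵢ`; therefore this residual is orthogonal to all functions of the
other coordinates. As strictly increasing transforms do not lose information, the other coordinates of `Y`
may be taken instead (`IsTranselliptical.integral_precisionResidual_mul_eq_zero`).

Given `Y_{(ij)}`, the residual divided by `Kᵢᵢ` is `Xᵢ - α + (Kᵢⱼ / Kᵢᵢ) Xⱼ` with a function `α` of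
`Y_{(ij)}`, and its orthogonality to functions of `Yⱼ` disintegrates over the conditioning variable.
It follows that `cov(Xᵢ, g(Yⱼ) | Y_{(ij)}) = 0` if `Kᵢⱼ = 0`, and that
`cov(Xᵢ, Xⱼ | Y_{(ij)}) = -(Kᵢⱼ / Kᵢᵢ) Var(Xⱼ | Y_{(ij)})` in general
(`IsTranselliptical.ae_condCov_eq`). The function `g` may be unbounded and `g(Yⱼ)` only conditionally
integrable, so the orthogonality is first used for truncations and then passed to the limit under
each conditional distribution.

For the converse, `g` is a Borel function with `g(Yⱼ) = Xⱼ` almost surely. If `Kᵢⱼ ≠ 0`, then the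
conditional variance of `Xⱼ` vanishes, so that `Xⱼ` is a function of the other coordinates. The
reflection along the `j`-th axis preserves this relation between the coordinates and the law of `X`,
which forces `(K (X - m))ⱼ = 0`. Then the characteristic generator is `1` on `[0, ∞)` and `X = m`
almost surely (`IsElliptical.ae_eq_of_ae_eq_apply`), against the positivity of the radius.
-/

/-! ### The reflection along a coordinate axis -/

/-- The `i`-th coordinate of `K (x - m)`. When the entry `K i i` is non-zero, this is `K i i` times
the difference of `x i` and an affine function of the other coordinates of `x`. -/
noncomputable def precisionResidual {d : ℕ} (m : EuclideanSpace ℝ (Fin d))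
    (K : Matrix (Fin d) (Fin d) ℝ) (i : Fin d) (x : EuclideanSpace ℝ (Fin d)) : ℝ :=
  (K *ᵥ (x - m).ofLp) i

/-- The reflection along the `i`-th axis which is orthogonal for the inner product with matrix `K`
and centre `m`. It moves only the `i`-th coordinate. -/
noncomputable def axisReflection {d : ℕ} (m : EuclideanSpace ℝ (Fin d))
    (K : Matrix (Fin d) (Fin d) ℝ) (i : Fin d) (x : EuclideanSpace ℝ (Fin d)) :
    EuclideanSpace ℝ (Fin d) :=
  x - EuclideanSpace.single i (2 / K i i * precisionResidual m K i x)

section Reflection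

variable {d : ℕ} {m : EuclideanSpace ℝ (Fin d)} {K : Matrix (Fin d) (Fin d) ℝ}

lemma precisionResidual_eq_sum (i : Fin d) (x : EuclideanSpace ℝ (Fin d)) :
    precisionResidual m K i x = ∑ k, K i k * (x k - m k) := rfl

lemma measurable_precisionResidual (i : Fin d) : Measurable (precisionResidual m K i) := by
  simp only [funext (precisionResidual_eq_sum i)]
  fun_prop

lemma axisReflection_apply_self (i : Fin d) (x : EuclideanSpace ℝ (Fin d)) :
    axisReflection m K i x i = x i - 2 / K i i * precisionResidual m K i x := by
  simp [axisReflection]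

lemma axisReflection_apply_of_ne {i k : Fin d} (h : k ≠ i) (x : EuclideanSpace ℝ (Fin d)) :
    axisReflection m K i x k = x k := by
  simp [axisReflection, h]

lemma measurable_axisReflection (i : Fin d) : Measurable (axisReflection m K i) := by
  refine (MeasurableEquiv.toLp 2 (Fin d → ℝ)).measurable.comp
    (measurable_pi_lambda (fun x k => axisReflection m K i x k) fun k => ?_)
  by_cases h : k = i
  · subst h
    simp only [axisReflection_apply_self]
    exact Measurable.sub (by fun_prop) ((measurable_precisionResidual k).const_mul _)
  · simp only [axisReflection_apply_of_ne h]
    fun_prop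

lemma precisionResidual_axisReflection {i : Fin d} (hi : K i i ≠ 0)
    (x : EuclideanSpace ℝ (Fin d)) :
    precisionResidual m K i (axisReflection m K i x) = - precisionResidual m K i x := by
  have h : precisionResidual m K i (axisReflection m K i x) =
      precisionResidual m K i x - K i i * (2 / K i i * precisionResidual m K i x) := by
    rw [precisionResidual_eq_sum, precisionResidual_eq_sum i x,
      ← Finset.add_sum_erase _ _ (Finset.mem_univ i),
      ← Finset.add_sum_erase (s := Finset.univ) (f := fun k => K i k * (x k - m k)) (a := i)
        (Finset.mem_univ i),
      Finset.sum_congr rfl (fun k hk => by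
        rw [axisReflection_apply_of_ne (Finset.ne_of_mem_erase hk)]),
      axisReflection_apply_self, precisionResidual_eq_sum,
      ← Finset.add_sum_erase (s := Finset.univ) (f := fun k => K i k * (x k - m k)) (a := i)
        (Finset.mem_univ i)]
    ring
  rw [h]
  field_simp
  ring

lemma inner_toLp_smul_mulVec_single (hK : Kᵀ = K) (c : ℝ) (i : Fin d)
    (y : EuclideanSpace ℝ (Fin d)) :
    inner ℝ y (WithLp.toLp 2 (c • (K *ᵥ Pi.single i 1))) = c * (K *ᵥ y.ofLp) i := by
  have h : (K *ᵥ y.ofLp) i = y.ofLp ⬝ᵥ (K *ᵥ Pi.single i 1) := by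
    rw [Matrix.dotProduct_mulVec, ← Matrix.mulVec_transpose, hK]
    simp
  rw [h, WithLp.toLp_smul, inner_smul_right, EuclideanSpace.inner_eq_star_dotProduct,
    dotProduct_comm]
  rfl

/-- A coordinate of `x - m` is bounded by the radius, by completing the square in the direction
`K⁻¹ eᵢ`. -/
lemma sq_le_mul_radiusSq (hK : K.PosDef) (i : Fin d) (x : EuclideanSpace ℝ (Fin d)) :
    (x i - m i) ^ 2 ≤ K⁻¹ i i * radiusSq m K x := by
  have hdet : IsUnit K.det := hK.det_pos.ne'.isUnit
  have hS : 0 < K⁻¹ i i := hK.inv.diag_pos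
  have hsymm : Kᵀ = K := by simpa using hK.isHermitian.eq
  set u : Fin d → ℝ := (x - m).ofLp with hu
  set e : Fin d → ℝ := Pi.single i 1
  set s : Fin d → ℝ := K⁻¹ *ᵥ e with hs
  have hKs : K *ᵥ s = e := by
    rw [hs, Matrix.mulVec_mulVec, Matrix.mul_nonsing_inv _ hdet, Matrix.one_mulVec]
  have hus : u ⬝ᵥ e = u i := by simp [e]
  have hse : s ⬝ᵥ e = K⁻¹ i i := by simp [e, hs]
  have hsu : s ⬝ᵥ (K *ᵥ u) = u i := by
    rw [Matrix.dotProduct_mulVec, ← Matrix.mulVec_transpose, hsymm, hKs, dotProduct_comm, hus]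
  have h0 := hK.posSemidef.dotProduct_mulVec_nonneg (K⁻¹ i i • u - u i • s)
  have hexp : (K⁻¹ i i • u - u i • s) ⬝ᵥ (K *ᵥ (K⁻¹ i i • u - u i • s)) =
      K⁻¹ i i * (K⁻¹ i i * radiusSq m K x - u i ^ 2) := by
    rw [radiusSq, ← hu, Matrix.mulVec_sub, Matrix.mulVec_smul, Matrix.mulVec_smul, hKs]
    simp only [sub_dotProduct, dotProduct_sub, smul_dotProduct, dotProduct_smul, smul_eq_mul,
      hus, hse, hsu]
    ring
  rw [star_trivial, hexp] at h0
  have := nonneg_of_mul_nonneg_right h0 hS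
  have hui : u i = x i - m i := rfl
  rw [← hui]
  linarith

end Reflection

/-! ### Elliptical laws -/

section Elliptical

variable {Ω : Type*} [MeasurableSpace Ω] {P : Measure Ω} [IsProbabilityMeasure P] {d : ℕ}
  {X : Ω → EuclideanSpace ℝ (Fin d)} {m : EuclideanSpace ℝ (Fin d)}
  {K : Matrix (Fin d) (Fin d) ℝ}

/-- An elliptical law is invariant under the reflection along a coordinate axis: the transposed
linear map preserves the quadratic form `t ↦ tᵀ K⁻¹ t`. -/
theorem IsElliptical.map_axisReflection (hX : IsElliptical X P m K⁻¹) (hK : K.PosDef)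
    (i : Fin d) : (P.map X).map (axisReflection m K i) = P.map X := by
  have : IsProbabilityMeasure (P.map X) := Measure.isProbabilityMeasure_map hX.aemeasurable
  have : IsProbabilityMeasure ((P.map X).map (axisReflection m K i)) :=
    Measure.isProbabilityMeasure_map (measurable_axisReflection i).aemeasurable
  obtain ⟨φ, hφ⟩ := hX.exists_charFun
  have hdet : IsUnit K.det := hK.det_pos.ne'.isUnit
  have hi : K i i ≠ 0 := hK.diag_pos.ne'
  have hsymm : Kᵀ = K := by simpa using hK.isHermitian.eq
  refine Measure.ext_of_charFun (funext fun t => ?_)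
  set c : ℝ := 2 / K i i * t i with hc
  set e : Fin d → ℝ := Pi.single i 1 with he
  -- the image of `t` under the transposed linear part of the reflection
  set t' : EuclideanSpace ℝ (Fin d) := t - WithLp.toLp 2 (c • (K *ᵥ e)) with ht'
  have hinner : ∀ y : EuclideanSpace ℝ (Fin d),
      inner ℝ y t' = inner ℝ y t - c * (K *ᵥ y.ofLp) i := by
    intro y
    rw [ht', inner_sub_right, inner_toLp_smul_mulVec_single hsymm]
  have hrefl : ∀ x : EuclideanSpace ℝ (Fin d), inner ℝ (axisReflection m K i x) t =
      inner ℝ x t' + c * (K *ᵥ m.ofLp) i := by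
    intro x
    rw [hinner, axisReflection, inner_sub_left, EuclideanSpace.inner_single_left]
    simp only [precisionResidual, WithLp.ofLp_sub, Matrix.mulVec_sub, Pi.sub_apply, hc]
    simp
    ring
  have hquad : t'.ofLp ⬝ᵥ (K⁻¹ *ᵥ t'.ofLp) = t.ofLp ⬝ᵥ (K⁻¹ *ᵥ t.ofLp) := by
    have hKK : K⁻¹ *ᵥ (K *ᵥ e) = e := by
      rw [Matrix.mulVec_mulVec, Matrix.nonsing_inv_mul _ hdet, Matrix.one_mulVec]
    have h2 : (K *ᵥ e) ⬝ᵥ (K⁻¹ *ᵥ t.ofLp) = t i := by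
      rw [← hsymm, Matrix.mulVec_transpose, ← Matrix.dotProduct_mulVec, hsymm,
        Matrix.mulVec_mulVec, Matrix.mul_nonsing_inv _ hdet, Matrix.one_mulVec]
      simp [he]
    have h3 : t.ofLp ⬝ᵥ e = t i := by simp [he]
    have h4 : (K *ᵥ e) ⬝ᵥ e = K i i := by simp [he]
    rw [ht', WithLp.ofLp_sub, Matrix.mulVec_sub, Matrix.mulVec_smul, hKK]
    simp only [sub_dotProduct, dotProduct_sub, smul_dotProduct, dotProduct_smul, smul_eq_mul,
      h2, h3, h4, hc]
    field_simp
    ring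
  have hmap : charFun ((P.map X).map (axisReflection m K i)) t =
      charFun (P.map X) t' * Complex.exp (Complex.I * (c * (K *ᵥ m.ofLp) i : ℝ)) := by
    rw [charFun_apply, charFun_apply, integral_map (measurable_axisReflection i).aemeasurable
      (by fun_prop), ← integral_mul_const]
    refine integral_congr_ae (Filter.Eventually.of_forall fun x => ?_)
    simp only [hrefl, ← Complex.exp_add]
    push_cast
    ring_nf
  rw [hmap, hφ t', hφ t, hquad, mul_assoc, ← Complex.exp_add, hinner m]
  push_cast
  ring_nf

/-- If one coordinate of `K (X - m)` vanishes almost surely, then `X = m` almost surely: the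
characteristic function along the line spanned by `K eⱼ` determines `φ`, which is the constant `1`
on `[0, ∞)`. -/
theorem IsElliptical.ae_eq_of_precisionResidual_eq_zero (hX : IsElliptical X P m K⁻¹)
    (hK : K.PosDef) (j : Fin d) (h : ∀ᵐ x ∂P.map X, precisionResidual m K j x = 0) :
    ∀ᵐ ω ∂P, X ω = m := by
  have : IsProbabilityMeasure (P.map X) := Measure.isProbabilityMeasure_map hX.aemeasurable
  obtain ⟨φ, hφ⟩ := hX.exists_charFun
  have hdet : IsUnit K.det := hK.det_pos.ne'.isUnit
  have hj : 0 < K j j := hK.diag_pos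
  have hsymm : Kᵀ = K := by simpa using hK.isHermitian.eq
  set e : Fin d → ℝ := Pi.single j 1 with he
  have hφ1 : ∀ u : ℝ, 0 ≤ u → φ u = 1 := by
    intro u hu
    set s : ℝ := √(u / K j j) with hs
    have hs2 : s * s * K j j = u := by
      rw [hs, Real.mul_self_sqrt (by positivity)]
      field_simp
    set t : EuclideanSpace ℝ (Fin d) := WithLp.toLp 2 (s • (K *ᵥ e)) with ht
    have hquad : t.ofLp ⬝ᵥ (K⁻¹ *ᵥ t.ofLp) = u := by
      have hKK : K⁻¹ *ᵥ (K *ᵥ e) = e := by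
        rw [Matrix.mulVec_mulVec, Matrix.nonsing_inv_mul _ hdet, Matrix.one_mulVec]
      have h4 : (K *ᵥ e) ⬝ᵥ e = K j j := by simp [he]
      rw [ht]
      simp only [Matrix.mulVec_smul, hKK, smul_dotProduct, dotProduct_smul, smul_eq_mul, h4]
      rw [← hs2]
      ring
    have hinner : ∀ x : EuclideanSpace ℝ (Fin d),
        inner ℝ x t = inner ℝ m t + s * precisionResidual m K j x := by
      intro x
      have h2 : inner ℝ (x - m) t = s * precisionResidual m K j x :=
        inner_toLp_smul_mulVec_single hsymm s j (x - m)
      rw [← h2, inner_sub_left]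
      ring
    have hchar : charFun (P.map X) t = Complex.exp (Complex.I * (inner ℝ m t : ℝ)) := by
      rw [charFun_apply, integral_congr_ae (g := fun _ =>
        Complex.exp (Complex.I * (inner ℝ m t : ℝ)))]
      · simp
      · filter_upwards [h] with x hx
        rw [hinner, hx, mul_zero, add_zero, mul_comm]
    have hcf := hφ t
    rw [hchar, hquad] at hcf
    exact_mod_cast (mul_eq_right₀ (Complex.exp_ne_zero _)).1 hcf.symm
  have hdirac : P.map X = Measure.dirac m := by
    refine Measure.ext_of_charFun (funext fun t => ?_)
    have h0 : 0 ≤ t.ofLp ⬝ᵥ (K⁻¹ *ᵥ t.ofLp) := by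
      simpa using hX.posSemidef.dotProduct_mulVec_nonneg t.ofLp
    rw [hφ t, hφ1 _ h0, charFun_dirac]
    simp [mul_comm]
  refine ae_of_ae_map hX.aemeasurable (p := fun x => x = m) ?_
  rw [hdirac]
  exact (ae_dirac_iff (measurableSet_singleton m)).2 rfl

/-- No integrability is needed: the integrand is antisymmetric under a reflection that preserves the
law, so that its Bochner integral vanishes in any case. -/
lemma IsElliptical.integral_precisionResidual_mul_eq_zero (hX : IsElliptical X P m K⁻¹)
    (hK : K.PosDef) (i : Fin d) {G : EuclideanSpace ℝ (Fin d) → ℝ} (hG : Measurable G)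
    (hinv : ∀ x, G (axisReflection m K i x) = G x) :
    ∫ x, precisionResidual m K i x * G x ∂P.map X = 0 := by
  have hmeas : Measurable fun x => precisionResidual m K i x * G x :=
    (measurable_precisionResidual i).mul hG
  have h : ∫ x, precisionResidual m K i x * G x ∂P.map X =
      - ∫ x, precisionResidual m K i x * G x ∂P.map X := by
    conv_lhs => rw [← hX.map_axisReflection hK i]
    rw [integral_map (measurable_axisReflection i).aemeasurable hmeas.aestronglyMeasurable,
      ← integral_neg]
    simp only [precisionResidual_axisReflection hK.diag_pos.ne', hinv, neg_mul]
  linarith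

/-- If a coordinate of an elliptical vector is a function of the others, then the vector is almost
surely constant: the reflection along its axis fixes that coordinate almost surely, and moves it by
a multiple of the residual. -/
theorem IsElliptical.ae_eq_of_ae_eq_apply (hX : IsElliptical X P m K⁻¹) (hK : K.PosDef)
    (j : Fin d) {G : EuclideanSpace ℝ (Fin d) → ℝ}
    (hinv : ∀ x, G (axisReflection m K j x) = G x)
    (h : ∀ᵐ x ∂P.map X, x j = G x) : ∀ᵐ ω ∂P, X ω = m := by
  refine hX.ae_eq_of_precisionResidual_eq_zero hK j ?_
  have h' := h
  rw [← hX.map_axisReflection hK j] at h'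
  filter_upwards [h, ae_of_ae_map (measurable_axisReflection j).aemeasurable h'] with x h1 h2
  rw [axisReflection_apply_self, hinv, ← h1] at h2
  have hj : 2 / K j j ≠ 0 := div_ne_zero two_ne_zero hK.diag_pos.ne'
  exact (mul_eq_zero.1 (by linarith : 2 / K j j * precisionResidual m K j x = 0)).resolve_left hj

end Elliptical

/-! ### Measurable versions of the marginal transforms -/

/-- A function that is monotone on an arbitrary set of reals agrees there with a Borel function. The
extension is made for the bounded function `arctan ∘ f`, as `f` itself need not have a real-valued
monotone extension. -/
lemma MonotoneOn.exists_measurable_eqOn {f : ℝ → ℝ} {D : Set ℝ} (hf : MonotoneOn f D) :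
    ∃ G : ℝ → ℝ, Measurable G ∧ Set.EqOn f G D := by
  obtain ⟨g, hg, hfg⟩ := MonotoneOn.exists_monotone_extension
    (f := fun x => Real.arctan (f x)) (s := D)
    (Real.arctan_strictMono.monotone.comp_monotoneOn hf)
    ⟨-(Real.pi / 2), by rintro _ ⟨x, -, rfl⟩; exact (Real.neg_pi_div_two_lt_arctan _).le⟩
    ⟨Real.pi / 2, by rintro _ ⟨x, -, rfl⟩; exact (Real.arctan_lt_pi_div_two _).le⟩
  have htan : Measurable Real.tan := by
    simp only [funext Real.tan_eq_sin_div_cos]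
    exact Real.measurable_sin.div Real.measurable_cos
  exact ⟨fun x => Real.tan (g x), htan.comp hg.measurable, fun x hx => by
    simp only [← hfg hx, Real.tan_arctan]⟩

lemma StrictMonoOn.exists_measurable_leftInvOn {f : ℝ → ℝ} {D : Set ℝ} (hf : StrictMonoOn f D) :
    ∃ G : ℝ → ℝ, Measurable G ∧ Set.LeftInvOn G f D := by
  have hmono : MonotoneOn (Function.invFunOn f D) (f '' D) := by
    rintro _ ⟨x, hx, rfl⟩ _ ⟨y, hy, rfl⟩ hxy
    rw [hf.injOn.leftInvOn_invFunOn hx, hf.injOn.leftInvOn_invFunOn hy]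
    exact (hf.le_iff_le hx hy).1 hxy
  obtain ⟨G, hG, hGe⟩ := hmono.exists_measurable_eqOn
  exact ⟨G, hG, fun x hx => by
    rw [← hGe (Set.mem_image_of_mem f hx), hf.injOn.leftInvOn_invFunOn hx]⟩

/-! ### Integrals under a regular conditional distribution -/

section CondDistrib

variable {Ω β : Type*} [MeasurableSpace Ω] [MeasurableSpace β] {P : Measure Ω}
  [IsProbabilityMeasure P] {W : Ω → ℝ × ℝ} {Z : Ω → β}

lemma ae_integral_condDistrib_eq_zero (hW : AEMeasurable W P) (hZ : AEMeasurable Z P)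
    {T : β × ℝ × ℝ → ℝ} (hT : Measurable T) (hint : Integrable (fun ω => T (Z ω, W ω)) P)
    (h : ∀ B, MeasurableSet B → ∫ ω, T (Z ω, W ω) * B.indicator 1 (Z ω) ∂P = 0) :
    ∀ᵐ z ∂P.map Z, ∫ p, T (z, p) ∂condDistrib W Z P z = 0 := by
  have : IsProbabilityMeasure (P.map Z) := Measure.isProbabilityMeasure_map hZ
  have hZW : AEMeasurable (fun ω => (Z ω, W ω)) P := hZ.prodMk hW
  have hint' : Integrable T (P.map Z ⊗ₘ condDistrib W Z P) := by
    rw [compProd_map_condDistrib hW]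
    exact (integrable_map_measure hT.aestronglyMeasurable hZW).2 hint
  refine Integrable.ae_eq_zero_of_forall_setIntegral_eq_zero hint'.integral_compProd
    fun B hB _ => ?_
  have h1 := Measure.setIntegral_compProd hB MeasurableSet.univ hint'.integrableOn
  simp only [Measure.restrict_univ] at h1
  rw [← h1, compProd_map_condDistrib hW, ← integral_indicator (hB.prod MeasurableSet.univ),
    integral_map hZW (hT.indicator (hB.prod MeasurableSet.univ)).aestronglyMeasurable, ← h B hB]
  refine integral_congr_ae (Filter.Eventually.of_forall fun ω => ?_)
  by_cases hω : Z ω ∈ B <;> simp [Set.indicator, hω]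

lemma ae_integrable_condDistrib (hW : AEMeasurable W P) (hZ : AEMeasurable Z P)
    {T : ℝ × ℝ → ℝ} (hT : Measurable T) (hint : Integrable (fun ω => T (W ω)) P) :
    ∀ᵐ z ∂P.map Z, Integrable T (condDistrib W Z P z) := by
  refine Integrable.condDistrib_ae_map (f := fun q : β × ℝ × ℝ => T q.2) hW ?_
  exact (integrable_map_measure (hT.comp measurable_snd).aestronglyMeasurable
    (hZ.prodMk hW)).2 hint

/-- If the second coordinate has almost surely a degenerate conditional distribution, then it is a
function of the conditioning variable. -/
lemma ae_eq_of_ae_condDistrib (hW : AEMeasurable W P) (hZ : AEMeasurable Z P) {c : β → ℝ}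
    (hc : Measurable c) (h : ∀ᵐ ω ∂P, ∀ᵐ p ∂condDistrib W Z P (Z ω), p.2 = c (Z ω)) :
    ∀ᵐ ω ∂P, (W ω).2 = c (Z ω) := by
  have : IsProbabilityMeasure (P.map Z) := Measure.isProbabilityMeasure_map hZ
  have hm : MeasurableSet {q : β × ℝ × ℝ | q.2.2 = c q.1} :=
    measurableSet_eq_fun (by fun_prop) (by fun_prop)
  have h1 : ∀ᵐ z ∂P.map Z, ∀ᵐ p ∂condDistrib W Z P z, p.2 = c z :=
    (ae_map_iff hZ (Kernel.measurable_kernel_prodMk_left hm.compl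
      (measurableSet_singleton 0))).2 h
  have h2 := (Measure.ae_compProd_iff hm).2 h1
  rw [compProd_map_condDistrib hW] at h2
  exact ae_of_ae_map (hZ.prodMk hW) h2

end CondDistrib

/-! ### Conditional covariances through truncation -/

/-- The truncation of a real number at level `n`: the number itself on `[-n, n]`, `0` outside. -/
noncomputable def truncateAt (n : ℕ) (v : ℝ) : ℝ := {v : ℝ | |v| ≤ n}.indicator id v

lemma measurable_truncateAt (n : ℕ) : Measurable (truncateAt n) :=
  measurable_id.indicator (measurableSet_le (by fun_prop) measurable_const)

lemma abs_truncateAt_le (n : ℕ) (v : ℝ) : |truncateAt n v| ≤ n := by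
  unfold truncateAt Set.indicator
  split_ifs with h
  · exact h
  · simp

lemma abs_truncateAt_le_abs (n : ℕ) (v : ℝ) : |truncateAt n v| ≤ |v| := by
  unfold truncateAt Set.indicator
  split_ifs with h
  · exact le_rfl
  · simp

lemma tendsto_truncateAt (v : ℝ) :
    Filter.Tendsto (fun n => truncateAt n v) Filter.atTop (nhds v) := by
  obtain ⟨N, hN⟩ := exists_nat_ge |v|
  refine tendsto_const_nhds.congr' ?_
  filter_upwards [Filter.eventually_ge_atTop N] with n hn
  have : |v| ≤ n := hN.trans (by exact_mod_cast hn)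
  simp [truncateAt, Set.indicator, this]

/-- If `u - a + b v` has mean zero and is orthogonal to the truncations of `v`, then
`cov(u, v) = -b Var(v)`. -/
lemma covariance_eq_of_integral_truncateAt {ν : Measure (ℝ × ℝ)} [IsProbabilityMeasure ν] {a b : ℝ}
    (hu : Integrable (fun p : ℝ × ℝ => p.1) ν) (hv : Integrable (fun p : ℝ × ℝ => p.2) ν)
    (huv : Integrable (fun p : ℝ × ℝ => p.1 * p.2) ν)
    (hvv : Integrable (fun p : ℝ × ℝ => b * p.2 ^ 2) ν)
    (h1 : ∫ p, (p.1 - a + b * p.2) ∂ν = 0)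
    (hn : ∀ n, ∫ p, (p.1 - a + b * p.2) * truncateAt n p.2 ∂ν = 0) :
    covariance (fun p : ℝ × ℝ => p.1) (fun p : ℝ × ℝ => p.2) ν =
      -b * ∫ p, (p.2 - ∫ q, q.2 ∂ν) ^ 2 ∂ν := by
  have hprod : Integrable (fun p : ℝ × ℝ => (p.1 - a + b * p.2) * p.2) ν := by
    refine ((huv.sub (hv.const_mul a)).add hvv).congr (Filter.Eventually.of_forall fun p => ?_)
    simp only [Pi.add_apply, Pi.sub_apply]
    ring
  have h2 : ∫ p, (p.1 - a + b * p.2) * p.2 ∂ν = 0 := by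
    refine tendsto_nhds_unique (tendsto_integral_of_dominated_convergence
      (F := fun n p => (p.1 - a + b * p.2) * truncateAt n p.2) _ (fun n => ?_) hprod.norm
      (fun n => ?_) ?_) (by simp only [hn]; exact tendsto_const_nhds)
    · exact Measurable.aestronglyMeasurable
        (Measurable.mul (by fun_prop) ((measurable_truncateAt n).comp measurable_snd))
    · refine Filter.Eventually.of_forall fun p => ?_
      rw [norm_mul, norm_mul]
      exact mul_le_mul_of_nonneg_left (abs_truncateAt_le_abs n p.2) (norm_nonneg _)
    · exact Filter.Eventually.of_forall fun p => (tendsto_truncateAt p.2).const_mul _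
  set c := ∫ q, q.2 ∂ν
  set e := ∫ q, q.1 ∂ν
  have he : e - a + b * c = 0 := by
    rw [← h1, integral_add (f := fun p : ℝ × ℝ => p.1 - a) (hu.sub (integrable_const a))
      (hv.const_mul b), integral_sub hu (integrable_const a), integral_const_mul]
    simp [e, c]
  have hcov : covariance (fun p : ℝ × ℝ => p.1) (fun p : ℝ × ℝ => p.2) ν +
      ∫ p, b * (p.2 - c) ^ 2 ∂ν = 0 := by
    have hi1 : Integrable (fun p : ℝ × ℝ => (p.1 - e) * (p.2 - c)) ν := by
      refine (((huv.sub (hv.const_mul e)).sub (hu.const_mul c)).add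
        (integrable_const (e * c))).congr (Filter.Eventually.of_forall fun p => ?_)
      simp only [Pi.add_apply, Pi.sub_apply]
      ring
    have hi2 : Integrable (fun p : ℝ × ℝ => b * (p.2 - c) ^ 2) ν := by
      refine ((hvv.sub (hv.const_mul (2 * b * c))).add
        (integrable_const (b * c ^ 2))).congr (Filter.Eventually.of_forall fun p => ?_)
      simp only [Pi.add_apply, Pi.sub_apply]
      ring
    have hi3 : Integrable (fun p : ℝ × ℝ => p.1 - a + b * p.2) ν :=
      (hu.sub (integrable_const a)).add (hv.const_mul b)
    calc covariance (fun p : ℝ × ℝ => p.1) (fun p : ℝ × ℝ => p.2) ν + ∫ p, b * (p.2 - c) ^ 2 ∂ν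
        = ∫ p, ((p.1 - e) * (p.2 - c) + b * (p.2 - c) ^ 2) ∂ν := (integral_add hi1 hi2).symm
      _ = ∫ p, ((p.1 - a + b * p.2) * p.2 - c * (p.1 - a + b * p.2)) ∂ν := by
          refine integral_congr_ae (Filter.Eventually.of_forall fun p => ?_)
          have : e = a - b * c := by linarith
          simp only [this]
          ring
      _ = 0 := by
          rw [integral_sub hprod (hi3.const_mul c), integral_const_mul, h1, h2]
          simp
  rw [integral_const_mul] at hcov
  linarith

/-! ### Transelliptical vectors -/

lemma measurable_latent_id {d : ℕ} {Φ : Fin d → ℝ → ℝ} (hΦ : ∀ k, Measurable (Φ k)) :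
    Measurable (latent Φ (id : EuclideanSpace ℝ (Fin d) → EuclideanSpace ℝ (Fin d))) :=
  (MeasurableEquiv.toLp 2 (Fin d → ℝ)).measurable.comp
    (measurable_pi_lambda (fun (x : EuclideanSpace ℝ (Fin d)) k => Φ k (x k)) fun k =>
      (hΦ k).comp (by fun_prop))

lemma measurable_removeTwo {d : ℕ} (i j : Fin d) : Measurable (removeTwo (d := d) i j) :=
  measurable_pi_lambda _ fun k => by simp only [removeTwo]; fun_prop

lemma sum_eq_add_add_sum_ne_and_ne {d : ℕ} {i j : Fin d} (hij : i ≠ j) (F : Fin d → ℝ) :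
    ∑ k, F k = F i + F j + ∑ k : {k : Fin d // k ≠ i ∧ k ≠ j}, F k.1 := by
  rw [← Finset.add_sum_erase _ _ (Finset.mem_univ i),
    ← Finset.add_sum_erase _ _ (Finset.mem_erase.2 ⟨hij.symm, Finset.mem_univ j⟩), add_assoc,
    Finset.sum_subtype ((Finset.univ.erase i).erase j) (p := fun k => k ≠ i ∧ k ≠ j)
      fun k => by simp [and_comm]]

section Transelliptical

variable {Ω : Type*} [MeasurableSpace Ω] {P : Measure Ω} {d : ℕ}
  {Y : Ω → EuclideanSpace ℝ (Fin d)} {f : Fin d → ℝ → ℝ} {m : EuclideanSpace ℝ (Fin d)}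
  {K : Matrix (Fin d) (Fin d) ℝ}

/-- Up to null sets, each `Y k` is a Borel function of `f k (Y k)` and conversely. -/
lemma IsTranselliptical.exists_measurable {S : Matrix (Fin d) (Fin d) ℝ}
    (hY : IsTranselliptical f Y P m S) :
    ∃ Φ Ψ : Fin d → ℝ → ℝ, (∀ k, Measurable (Φ k)) ∧ (∀ k, Measurable (Ψ k)) ∧
      ∀ᵐ ω ∂P, ∀ k, Φ k (f k (Y ω k)) = Y ω k ∧ Ψ k (Y ω k) = f k (Y ω k) := by
  choose D hD hf using hY.strictMono
  choose Φ hΦ hΦf using fun k => (hf k).exists_measurable_leftInvOn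
  choose Ψ hΨ hΨf using fun k => (hf k).monotoneOn.exists_measurable_eqOn
  refine ⟨Φ, Ψ, hΦ, hΨ, ?_⟩
  filter_upwards [ae_all_iff.2 hD] with ω hω k
  exact ⟨hΦf k (hω k), (hΨf k (hω k)).symm⟩

lemma IsTranselliptical.aemeasurable_apply {S : Matrix (Fin d) (Fin d) ℝ}
    (hY : IsTranselliptical f Y P m S) (k : Fin d) :
    AEMeasurable (fun ω => f k (Y ω k)) P :=
  (show Measurable fun x : EuclideanSpace ℝ (Fin d) => x k by fun_prop).comp_aemeasurable
    hY.elliptical.aemeasurable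

variable [IsProbabilityMeasure P]

/-- The residual of `f i (Y i)` is orthogonal to all functions of the other coordinates of `Y`. -/
lemma IsTranselliptical.integral_precisionResidual_mul_eq_zero
    (hY : IsTranselliptical f Y P m K⁻¹) (hK : K.PosDef) (i : Fin d)
    {χ : EuclideanSpace ℝ (Fin d) → ℝ} (hχ : Measurable χ)
    (hχi : ∀ y y' : EuclideanSpace ℝ (Fin d), (∀ k, k ≠ i → y k = y' k) → χ y = χ y') :
    ∫ ω, precisionResidual m K i (latent f Y ω) * χ (Y ω) ∂P = 0 := by
  obtain ⟨Φ, _, hΦ, -, hΦY⟩ := hY.exists_measurable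
  have hmeas := measurable_latent_id hΦ
  have h := hY.elliptical.integral_precisionResidual_mul_eq_zero hK i (hχ.comp hmeas)
    fun x => hχi _ _ fun k hk => by
      simp only [latent, id, axisReflection_apply_of_ne hk]
  rw [integral_map hY.elliptical.aemeasurable (Measurable.aestronglyMeasurable
    ((measurable_precisionResidual i).fun_mul (hχ.comp hmeas)))] at h
  rw [← h]
  refine integral_congr_ae ?_
  filter_upwards [hΦY] with ω hω
  have : latent Φ id (latent f Y ω) = Y ω := by
    ext k
    exact (hω k).1
  simp only [Function.comp_apply, this]

lemma IsTranselliptical.memLp_two (hY : IsTranselliptical f Y P m K⁻¹) (hK : K.PosDef)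
    (hint : Integrable (fun ω => radiusSq m K (latent f Y ω)) P) (k : Fin d) :
    MemLp (fun ω => f k (Y ω k)) 2 P := by
  have h : MemLp (fun ω => f k (Y ω k) - m k) 2 P := by
    refine (memLp_two_iff_integrable_sq
      ((hY.aemeasurable_apply k).sub_const _).aestronglyMeasurable).2 ?_
    refine (hint.const_mul (K⁻¹ k k)).mono'
      (((hY.aemeasurable_apply k).sub_const _).pow_const 2).aestronglyMeasurable
      (Filter.Eventually.of_forall fun ω => ?_)
    rw [Real.norm_of_nonneg (sq_nonneg _)]
    exact sq_le_mul_radiusSq hK k (latent f Y ω)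
  refine (memLp_congr_ae (Filter.Eventually.of_forall fun ω => ?_)).1 (h.add (memLp_const (m k)))
  simp

/-- The conditional covariance of `f i (Y i)` and `g (Y j)`, where `g (Y j)` is arbitrary if
`K i j = 0` and stands for `f j (Y j)` otherwise. Conditionally on `Y_{(ij)}`, the residual of
`f i (Y i)` is an affine function of `f i (Y i)` and `f j (Y j)` which is orthogonal to the
functions of `Y j`. -/
theorem IsTranselliptical.ae_condCov_eq (hY : IsTranselliptical f Y P m K⁻¹) (hK : K.PosDef)
    (hint : Integrable (fun ω => radiusSq m K (latent f Y ω)) P) {i j : Fin d} (hij : i ≠ j)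
    {g : ℝ → ℝ} (hg : Measurable g)
    (hgf : ∀ᵐ ω ∂P, K i j * g (Y ω j) = K i j * f j (Y ω j))
    (hex : ∀ᵐ ω ∂P, CondCovExists (fun ω' => f i (Y ω' i)) (fun ω' => g (Y ω' j))
      (fun ω' => removeTwo i j (Y ω')) P (removeTwo i j (Y ω))) :
    ∀ᵐ ω ∂P, condCov (fun ω' => f i (Y ω' i)) (fun ω' => g (Y ω' j))
        (fun ω' => removeTwo i j (Y ω')) P (removeTwo i j (Y ω)) =
      -(K i j / K i i) * ∫ p, (p.2 - ∫ q, q.2 ∂condDistrib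
          (fun ω' => (f i (Y ω' i), g (Y ω' j))) (fun ω' => removeTwo i j (Y ω')) P
          (removeTwo i j (Y ω))) ^ 2
        ∂condDistrib (fun ω' => (f i (Y ω' i), g (Y ω' j)))
          (fun ω' => removeTwo i j (Y ω')) P (removeTwo i j (Y ω)) := by
  have hii : K i i ≠ 0 := hK.diag_pos.ne'
  obtain ⟨_, Ψ, -, hΨ, hΨY⟩ := hY.exists_measurable
  set b : ℝ := K i j / K i i with hb
  have hZ : AEMeasurable (fun ω => removeTwo i j (Y ω)) P :=
    (measurable_removeTwo i j).comp_aemeasurable hY.aemeasurable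
  have hYj : AEMeasurable (fun ω => Y ω j) P :=
    (show Measurable fun x : EuclideanSpace ℝ (Fin d) => x j by fun_prop).comp_aemeasurable
      hY.aemeasurable
  have hW : AEMeasurable (fun ω => (f i (Y ω i), g (Y ω j))) P :=
    (hY.aemeasurable_apply i).prodMk (hg.comp_aemeasurable hYj)
  -- the part of the residual that depends on `Y_{(ij)}` only
  set α : ({k : Fin d // k ≠ i ∧ k ≠ j} → ℝ) → ℝ := fun z =>
    m i + b * m j - ∑ k : {k : Fin d // k ≠ i ∧ k ≠ j}, K i k / K i i * (Ψ k (z k) - m k) with hα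
  have hαm : Measurable α :=
    measurable_const.sub (Finset.measurable_sum _ fun k _ =>
      (((hΨ k).comp (measurable_pi_apply k)).sub_const _).const_mul _)
  have hres : ∀ᵐ ω ∂P, f i (Y ω i) - α (removeTwo i j (Y ω)) + b * g (Y ω j) =
      (K i i)⁻¹ * precisionResidual m K i (latent f Y ω) := by
    filter_upwards [hΨY, hgf] with ω hω hgω
    have h1 : ∑ k : {k : Fin d // k ≠ i ∧ k ≠ j},
        K i k / K i i * (Ψ k (removeTwo i j (Y ω) k) - m k) =
        (K i i)⁻¹ * ∑ k : {k : Fin d // k ≠ i ∧ k ≠ j}, K i k * (f k (Y ω k) - m k) := by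
      rw [Finset.mul_sum]
      refine Finset.sum_congr rfl fun k _ => ?_
      rw [removeTwo, (hω k).2]
      ring
    have h2 : b * g (Y ω j) = b * f j (Y ω j) := by
      rw [hb, div_mul_eq_mul_div, div_mul_eq_mul_div, hgω]
    rw [precisionResidual_eq_sum, sum_eq_add_add_sum_ne_and_ne hij, hα, h2]
    simp only [h1, latent, hb]
    field_simp
    ring
  have hresint : Integrable (fun ω => (K i i)⁻¹ * precisionResidual m K i (latent f Y ω)) P := by
    refine Integrable.const_mul ?_ _
    simp only [precisionResidual_eq_sum]
    exact integrable_finsetSum _ fun k _ => ((((hY.memLp_two hK hint k).integrable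
      (by norm_num)).sub (integrable_const (m k))).const_mul (K i k))
  -- orthogonality of the residual to functions of `Y j`, conditionally on `Y_{(ij)}`
  have horth : ∀ ψ : ℝ → ℝ, Measurable ψ →
      Integrable (fun ω => (f i (Y ω i) - α (removeTwo i j (Y ω)) + b * g (Y ω j)) *
        ψ (g (Y ω j))) P →
      ∀ᵐ ω ∂P, ∫ p, (p.1 - α (removeTwo i j (Y ω)) + b * p.2) * ψ p.2
        ∂condDistrib (fun ω' => (f i (Y ω' i), g (Y ω' j)))
          (fun ω' => removeTwo i j (Y ω')) P (removeTwo i j (Y ω)) = 0 := by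
    intro ψ hψ hψint
    refine ae_of_ae_map hZ (ae_integral_condDistrib_eq_zero hW hZ
      (T := fun q => (q.2.1 - α q.1 + b * q.2.2) * ψ q.2.2) (by fun_prop) hψint
      fun B hB => ?_)
    have h := hY.integral_precisionResidual_mul_eq_zero hK i
      (χ := fun y => (K i i)⁻¹ * (ψ (g (y j)) * B.indicator 1 (removeTwo i j y)))
      ((((hψ.comp hg).comp (by fun_prop)).mul
        ((measurable_one.indicator hB).comp (measurable_removeTwo i j))).const_mul _)
      fun y y' hyy => by
        have : removeTwo i j y = removeTwo i j y' := funext fun k => hyy k k.2.1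
        simp only [this, hyy j hij.symm]
    rw [← h]
    refine integral_congr_ae ?_
    filter_upwards [hres] with ω hω
    simp only [hω]
    ring
  have h1 := horth (fun _ => 1) measurable_const
    (by simpa using hresint.congr (hres.mono fun ω hω => hω.symm))
  have hn : ∀ᵐ ω ∂P, ∀ n, ∫ p, (p.1 - α (removeTwo i j (Y ω)) + b * p.2) * truncateAt n p.2
        ∂condDistrib (fun ω' => (f i (Y ω' i), g (Y ω' j)))
          (fun ω' => removeTwo i j (Y ω')) P (removeTwo i j (Y ω)) = 0 := by
    refine ae_all_iff.2 fun n => horth _ (measurable_truncateAt n) ?_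
    refine (hresint.congr (hres.mono fun ω hω => hω.symm)).mul_bdd (c := n)
      (((measurable_truncateAt n).comp hg).comp_aemeasurable hYj).aestronglyMeasurable
      (Filter.Eventually.of_forall fun ω => abs_truncateAt_le n _)
  have hsq : ∀ᵐ ω ∂P, Integrable (fun p : ℝ × ℝ => b * p.2 ^ 2)
      (condDistrib (fun ω' => (f i (Y ω' i), g (Y ω' j)))
          (fun ω' => removeTwo i j (Y ω')) P (removeTwo i j (Y ω))) := by
    refine ae_of_ae_map hZ (ae_integrable_condDistrib hW hZ (T := fun p => b * p.2 ^ 2)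
      (by fun_prop) ?_)
    refine ((hY.memLp_two hK hint j).integrable_sq.const_mul b).congr ?_
    filter_upwards [hgf] with ω hω
    rcases eq_or_ne (K i j) 0 with h0 | h0
    · simp [hb, h0]
    · rw [mul_left_cancel₀ h0 hω]
  filter_upwards [hex, h1, hn, hsq] with ω hexω h1ω hnω hsqω
  simp only [mul_one] at h1ω
  exact covariance_eq_of_integral_truncateAt hexω.1 hexω.2.1 hexω.2.2 hsqω h1ω hnω

end Transelliptical

/-! ### Zeros of the precision matrix -/

theorem mainTheorem2 {Ω : Type*} [MeasurableSpace Ω] (P : Measure Ω) [IsProbabilityMeasure P]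
    (d : ℕ) (Y : Ω → EuclideanSpace ℝ (Fin d)) (f : Fin d → ℝ → ℝ)
    (m : EuclideanSpace ℝ (Fin d)) (K : Matrix (Fin d) (Fin d) ℝ) (hK : K.PosDef)
    (hY : IsTranselliptical f Y P m K⁻¹)
    (hint : Integrable (fun ω => radiusSq m K (latent f Y ω)) P)
    (hpos : 0 < ∫ ω, radiusSq m K (latent f Y ω) ∂P)
    (i j : Fin d) (hij : i ≠ j) :
    K i j = 0 ↔
      ∀ g : ℝ → ℝ, Measurable g →
        (∀ᵐ ω ∂P, CondCovExists (fun ω' => f i (Y ω' i)) (fun ω' => g (Y ω' j))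
          (fun ω' => removeTwo i j (Y ω')) P (removeTwo i j (Y ω))) →
        ∀ᵐ ω ∂P, condCov (fun ω' => f i (Y ω' i)) (fun ω' => g (Y ω' j))
          (fun ω' => removeTwo i j (Y ω')) P (removeTwo i j (Y ω)) = 0 := by
  constructor
  · intro h0 g hg hex
    filter_upwards [hY.ae_condCov_eq hK hint hij hg (by simp [h0]) hex] with ω hω
    simpa [h0] using hω
  · intro h
    by_contra h0
    obtain ⟨Φ, Ψ, hΦ, hΨ, hΦΨ⟩ := hY.exists_measurable
    have hgf : ∀ᵐ ω ∂P, Ψ j (Y ω j) = f j (Y ω j) := by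
      filter_upwards [hΦΨ] with ω hω using (hω j).2
    have hZ : AEMeasurable (fun ω => removeTwo i j (Y ω)) P :=
      (measurable_removeTwo i j).comp_aemeasurable hY.aemeasurable
    have hV2 : MemLp (fun ω => Ψ j (Y ω j)) 2 P :=
      (memLp_congr_ae hgf).2 (hY.memLp_two hK hint j)
    have hU2 := hY.memLp_two hK hint i
    have hW : AEMeasurable (fun ω => (f i (Y ω i), Ψ j (Y ω j))) P :=
      hU2.aemeasurable.prodMk hV2.aemeasurable
    have hex : ∀ᵐ ω ∂P, CondCovExists (fun ω' => f i (Y ω' i)) (fun ω' => Ψ j (Y ω' j))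
        (fun ω' => removeTwo i j (Y ω')) P (removeTwo i j (Y ω)) := by
      filter_upwards [
        ae_of_ae_map hZ (ae_integrable_condDistrib hW hZ measurable_fst
          (hU2.integrable (by norm_num))),
        ae_of_ae_map hZ (ae_integrable_condDistrib hW hZ measurable_snd
          (hV2.integrable (by norm_num))),
        ae_of_ae_map hZ (ae_integrable_condDistrib hW hZ (measurable_fst.mul measurable_snd)
          (hU2.integrable_mul hV2))] with ω h1 h2 h3
      exact ⟨h1, h2, h3⟩
    have hsq := ae_of_ae_map hZ (ae_integrable_condDistrib hW hZ
      (T := fun p => p.2 ^ 2) (by fun_prop) hV2.integrable_sq)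
    set c : ({k : Fin d // k ≠ i ∧ k ≠ j} → ℝ) → ℝ := fun z => ∫ q, q.2
      ∂condDistrib (fun ω' => (f i (Y ω' i), Ψ j (Y ω' j)))
        (fun ω' => removeTwo i j (Y ω')) P z with hc
    have hcm : Measurable c :=
      (StronglyMeasurable.integral_condDistrib
        (f := fun q : ({k : Fin d // k ≠ i ∧ k ≠ j} → ℝ) × ℝ × ℝ => q.2.2)
        (by fun_prop : Measurable _).stronglyMeasurable).measurable
    -- the conditional variance of `f j (Y j)` given `Y_{(ij)}` vanishes
    have hVc : ∀ᵐ ω ∂P, Ψ j (Y ω j) = c (removeTwo i j (Y ω)) := by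
      refine ae_eq_of_ae_condDistrib hW hZ hcm ?_
      filter_upwards [hY.ae_condCov_eq hK hint hij (hΨ j)
        (hgf.mono fun ω hω => by rw [hω]) hex, h (Ψ j) (hΨ j) hex, hex, hsq] with ω h1 h2 h3 h4
      rw [h2, zero_eq_mul] at h1
      have h5 := h1.resolve_left (neg_ne_zero.2 (div_ne_zero h0 hK.diag_pos.ne'))
      have hi2 : Integrable (fun p : ℝ × ℝ => (p.2 - c (removeTwo i j (Y ω))) ^ 2)
          (condDistrib (fun ω' => (f i (Y ω' i), Ψ j (Y ω' j)))
            (fun ω' => removeTwo i j (Y ω')) P (removeTwo i j (Y ω))) := by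
        refine ((h4.sub (h3.2.1.const_mul (2 * c (removeTwo i j (Y ω))))).add
          (integrable_const (c (removeTwo i j (Y ω)) ^ 2))).congr
            (Filter.Eventually.of_forall fun p => ?_)
        simp only [Pi.add_apply, Pi.sub_apply]
        ring
      filter_upwards [(integral_eq_zero_iff_of_nonneg (fun p => sq_nonneg _) hi2).1 h5] with p hp
      exact sub_eq_zero.1 (pow_eq_zero_iff two_ne_zero |>.1 hp)
    -- hence `f j (Y j)` is a function of the other latent coordinates, and the law is degenerate
    have hΦm := measurable_latent_id hΦ
    have hdeg := hY.elliptical.ae_eq_of_ae_eq_apply hK j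
      (G := fun x => c (removeTwo i j (latent Φ id x)))
      (fun x => congrArg c (funext fun k => by
        simp only [removeTwo, latent, id, axisReflection_apply_of_ne k.2.2]))
      ((ae_map_iff hY.elliptical.aemeasurable (measurableSet_eq_fun (by fun_prop)
        (hcm.comp ((measurable_removeTwo i j).comp hΦm)))).2 (by
          filter_upwards [hΦΨ, hgf, hVc] with ω h1 h2 h3
          have : latent Φ id (latent f Y ω) = Y ω := by
            ext k
            exact (h1 k).1
          rw [Function.comp_apply, Function.comp_apply, this, ← h3, h2]
          rfl))
    have hzero : ∫ ω, radiusSq m K (latent f Y ω) ∂P = 0 := by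
      rw [integral_congr_ae (g := fun _ => (0 : ℝ)) (hdeg.mono fun ω hω => by
        simp [hω, radiusSq])]
      simp
    exact hpos.ne' hzero
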